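/- Let $(X,\mathcal X,\mu)$ be a probability space, let $d\ge 1$, and let $S_1,\dots,S_d$ be invertible (with measurable inverse) measure-preserving transformations of $X$ that commute: $S_iS_k=S_kS_i$ for all $i,k$. Let $f_1,\dots,f_d\in L^\infty(\mu)$ be real-valued, and for $n\in\mathbb Z$ write $S_i^nf_i:=f_i\circ S_i^n$. Let $(I_j)_{j\ge1}$ be any sequence of finite intervals in $\mathbb Z$ whose lengths (numbers of elements) $|I_j|$ tend to infinity. Then the averages $$\frac1{|I_j|}\sum_{n\in I_j}S_1^nf_1\cdot S_2^nf_2\cdots S_d^nf_d$$ converge in $L^2(\mu)$ as $j\to\infty$; that is, there is $g\in L^2(\mu)$ with $$\lim_{j\to\infty}\Bigl\|\frac1{|I_j|}\sum_{n\in I_j}S_1^nf_1\cdots S_d^nf_d-g\Bigr\|_{L^2(\mu)}=0.$$ -/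

import Mathlib

open MeasureTheory Filter Topology
open scoped ENNReal

/-- The function `S ^ n f`, that is `x ↦ f (S ^ n x)`, for an invertible measurable
transformation `S` and an integer `n` (possibly negative; the power is taken in the group of
permutations of `X`). -/
def transPow {X : Type*} [MeasurableSpace X] (S : X ≃ᵐ X) (n : ℤ) (f : X → ℝ) : X → ℝ :=
  fun x => f (((S.toEquiv : Equiv.Perm X) ^ n) x)

/-- The multiple average `(1 / |I|) ∑_{n ∈ I} S₁ ^ n f₁ ⋯ S_d ^ n f_d`. -/
noncomputable def multipleAverage {X : Type*} [MeasurableSpace X] {d : ℕ}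
    (S : Fin d → X ≃ᵐ X) (f : Fin d → X → ℝ) (I : Finset ℤ) : X → ℝ :=
  fun x => (1 / (I.card : ℝ)) * ∑ n ∈ I, ∏ i, transPow (S i) n (f i) x

/-- A sequence of functions converges in `L²(μ)` (to some element of `L²(μ)`). -/
def ConvergesInL2 {X : Type*} [MeasurableSpace X] (μ : Measure X) (F : ℕ → X → ℝ) : Prop :=
  (∀ j, MemLp (F j) 2 μ) ∧
    ∃ g : X → ℝ, MemLp g 2 μ ∧ Tendsto (fun j => eLpNorm (F j - g) 2 μ) atTop (𝓝 0)

/-! ### Averages over integer intervals -/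

section Averages

variable {E F : Type*} [NormedAddCommGroup E] [NormedSpace ℝ E]
  [NormedAddCommGroup F] [NormedSpace ℝ F]

/-! The proof is by induction on the number of transformations, over all invariant states on
commutative normed algebras at once; the claim is that the averages are Cauchy in the `L²` seminorm
of the state, uniformly over all long intervals. States need not come from measures, so the
induction may pass to finitely additive means.

For the inductive step, single out `t = s 0`. The average becomes a linear operator `A` applied to
`a 0`, namely `b ↦ avg_n τ n * t ^ n b` with `τ` the product of the other terms. The vectors along
which these operators are uniformly Cauchy form a closed subspace. If `u` is orthogonal to it and
its averages over arbitrarily long intervals stay large, then `u` correlates with the dual functions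
`A* A u'`, where `u'` approximates `u`, and hence with a weak limit of them. So it suffices that
dual functions over longer and longer intervals are asymptotically uniformly Cauchy
(`cauchy_twistedAvg_of_dual`): then that limit lies in the subspace, a contradiction.

For dual functions, the change of variables `n = m + l` turns the average over `l` of `τ l * t ^ l
(A* h)` into an average over `m` of `t ^ (-m) h` times the multiple average, over `l`, of the
remaining transformations acting on `a i * (t⁻¹ s i) ^ m a i`
(`norm_twistedAvg_twistedDual_sub_le`). These coefficients are bounded families indexed by `m`, and
the mean over `m` along an ultrafilter is again an invariant state. The induction hypothesis for
`meanState` then gives a threshold independent of `m`, which finishes the step in `cauchy_multTerm`.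
-/

/-- The average of `c` over the interval `[p, p + L)` of integers. -/
noncomputable def intervalAvg (c : ℤ → E) (p : ℤ) (L : ℕ) : E :=
  (L : ℝ)⁻¹ • ∑ k ∈ Finset.range L, c (p + k)

theorem intervalAvg_mono {c c' : ℤ → ℝ} (h : ∀ n, c n ≤ c' n) (p : ℤ) (L : ℕ) :
    intervalAvg c p L ≤ intervalAvg c' p L := by
  unfold intervalAvg
  simp only [smul_eq_mul]
  gcongr
  exact h _

theorem norm_intervalAvg_le_intervalAvg (c : ℤ → E) (p : ℤ) (L : ℕ) :
    ‖intervalAvg c p L‖ ≤ intervalAvg (fun n => ‖c n‖) p L := by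
  unfold intervalAvg
  rw [norm_smul, norm_inv, smul_eq_mul, Real.norm_natCast]
  gcongr
  exact norm_sum_le _ _

theorem intervalAvg_const (v : E) (p : ℤ) {L : ℕ} (hL : L ≠ 0) :
    intervalAvg (fun _ => v) p L = v := by
  have : (L : ℝ) ≠ 0 := by exact_mod_cast hL
  simp only [intervalAvg, Finset.sum_const, Finset.card_range]
  rw [← Nat.cast_smul_eq_nsmul ℝ, smul_smul, inv_mul_cancel₀ this, one_smul]

theorem norm_intervalAvg_le {c : ℤ → E} {C : ℝ} (hC : 0 ≤ C) (h : ∀ n, ‖c n‖ ≤ C)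
    (p : ℤ) (L : ℕ) : ‖intervalAvg c p L‖ ≤ C := by
  rcases eq_or_ne L 0 with rfl | hL
  · simpa [intervalAvg] using hC
  · calc ‖intervalAvg c p L‖ ≤ intervalAvg (fun n => ‖c n‖) p L :=
          norm_intervalAvg_le_intervalAvg c p L
      _ ≤ intervalAvg (fun _ => C) p L := intervalAvg_mono h p L
      _ = C := intervalAvg_const C p hL

theorem map_intervalAvg {𝓕 : Type*} [FunLike 𝓕 E F] [LinearMapClass 𝓕 ℝ E F] (f : 𝓕)
    (c : ℤ → E) (p : ℤ) (L : ℕ) :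
    f (intervalAvg c p L) = intervalAvg (fun n => f (c n)) p L := by
  simp [intervalAvg, map_smul, map_sum]

theorem intervalAvg_sub (c c' : ℤ → E) (p : ℤ) (L : ℕ) :
    intervalAvg (fun n => c n - c' n) p L = intervalAvg c p L - intervalAvg c' p L := by
  simp [intervalAvg, Finset.sum_sub_distrib, smul_sub]

theorem intervalAvg_add (c c' : ℤ → E) (p : ℤ) (L : ℕ) :
    intervalAvg (fun n => c n + c' n) p L = intervalAvg c p L + intervalAvg c' p L := by
  simp [intervalAvg, Finset.sum_add_distrib, smul_add]

theorem intervalAvg_smul (r : ℝ) (c : ℤ → E) (p : ℤ) (L : ℕ) :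
    intervalAvg (fun n => r • c n) p L = r • intervalAvg c p L := by
  simp only [intervalAvg, ← Finset.smul_sum]
  rw [smul_comm]

theorem intervalAvg_comm (c : ℤ → ℤ → E) (p q : ℤ) (L M : ℕ) :
    intervalAvg (fun n => intervalAvg (c n) q M) p L =
      intervalAvg (fun m => intervalAvg (fun n => c n m) p L) q M := by
  simp only [intervalAvg, ← Finset.smul_sum]
  rw [smul_comm, Finset.sum_comm]

theorem intervalAvg_sq_le (c : ℤ → ℝ) (p : ℤ) (L : ℕ) :
    intervalAvg c p L ^ 2 ≤ intervalAvg (fun n => c n ^ 2) p L := by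
  rcases eq_or_ne L 0 with rfl | hL
  · simp [intervalAvg]
  have hL' : (0 : ℝ) < L := by exact_mod_cast Nat.pos_of_ne_zero hL
  have h := sq_sum_le_card_mul_sum_sq (s := Finset.range L) (f := fun k : ℕ => c (p + k))
  rw [Finset.card_range] at h
  simp only [intervalAvg, smul_eq_mul, mul_pow]
  calc ((L : ℝ)⁻¹) ^ 2 * (∑ k ∈ Finset.range L, c (p + k)) ^ 2
      ≤ ((L : ℝ)⁻¹) ^ 2 * (L * ∑ k ∈ Finset.range L, c (p + k) ^ 2) := by gcongr
    _ = (L : ℝ)⁻¹ * ∑ k ∈ Finset.range L, c (p + k) ^ 2 := by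
        field_simp

theorem norm_intervalAvg_shift_one_sub_le {c : ℤ → E} {C : ℝ} (h : ∀ n, ‖c n‖ ≤ C)
    (p : ℤ) (L : ℕ) :
    ‖intervalAvg (fun n => c (n + 1)) p L - intervalAvg c p L‖ ≤ (L : ℝ)⁻¹ * (2 * C) := by
  -- The difference telescopes to its two boundary terms.
  have h1 : intervalAvg (fun n => c (n + 1)) p L - intervalAvg c p L =
      (L : ℝ)⁻¹ • (c (p + L) - c p) := by
    have h2 := Finset.sum_range_sub (fun k : ℕ => c (p + k)) L
    rw [Finset.sum_sub_distrib] at h2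
    simp only [intervalAvg, ← smul_sub]
    congr 1
    simpa [add_assoc] using h2
  rw [h1, norm_smul, norm_inv, Real.norm_natCast]
  gcongr
  calc ‖c (p + L) - c p‖ ≤ ‖c (p + L)‖ + ‖c p‖ := norm_sub_le _ _
    _ ≤ 2 * C := by linarith [h (p + L), h p]

theorem norm_intervalAvg_shift_nat_sub_le {c : ℤ → E} {C : ℝ} (h : ∀ n, ‖c n‖ ≤ C)
    (l : ℕ) (p : ℤ) (L : ℕ) :
    ‖intervalAvg (fun n => c (n + l)) p L - intervalAvg c p L‖ ≤ l * ((L : ℝ)⁻¹ * (2 * C)) := by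
  induction l with
  | zero => simp
  | succ l ih =>
    have h1 := norm_intervalAvg_shift_one_sub_le (c := fun n => c (n + l)) (fun n => h _) p L
    have h2 : (fun n : ℤ => c (n + (l + 1 : ℕ))) = fun n => c (n + 1 + l) := by
      funext n; congr 1; push_cast; ring
    rw [h2]
    calc _ ≤ ‖intervalAvg (fun n => c (n + 1 + l)) p L - intervalAvg (fun n => c (n + l)) p L‖
          + ‖intervalAvg (fun n => c (n + l)) p L - intervalAvg c p L‖ :=
          norm_sub_le_norm_sub_add_norm_sub _ _ _
      _ ≤ _ := by push_cast; linarith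

/-- Averages of a bounded sequence over long intervals are almost invariant under shifts. -/
theorem norm_intervalAvg_shift_sub_le {c : ℤ → E} {C : ℝ} (h : ∀ n, ‖c n‖ ≤ C)
    (l : ℤ) (p : ℤ) (L : ℕ) :
    ‖intervalAvg (fun n => c (n + l)) p L - intervalAvg c p L‖ ≤
      l.natAbs * ((L : ℝ)⁻¹ * (2 * C)) := by
  rcases Int.natAbs_eq l with hl | hl
  · have := norm_intervalAvg_shift_nat_sub_le h l.natAbs p L
    rwa [← hl] at this
  -- For negative `l`, the sequence `c` is the shift by `-l` of its own shift by `l`.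
  · have h1 := norm_intervalAvg_shift_nat_sub_le (c := fun n => c (n + l)) (fun n => h _)
      l.natAbs p L
    rw [norm_sub_rev]
    have h2 : (fun n => c (n + l.natAbs + l)) = c := by
      funext n
      congr 1
      omega
    rwa [h2] at h1

end Averages

/-! ### Limits along an ultrafilter -/

/-- The limit of a bounded sequence of reals along a fixed nonprincipal ultrafilter. -/
noncomputable def ultraLim (x : ℕ → ℝ) : ℝ := limUnder (hyperfilter ℕ : Filter ℕ) x

theorem tendsto_ultraLim {x : ℕ → ℝ} {C : ℝ} (h : ∀ j, |x j| ≤ C) :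
    Tendsto x (hyperfilter ℕ) (𝓝 (ultraLim x)) := by
  have hc : IsCompact (Set.Icc (-C) C) := isCompact_Icc
  obtain ⟨l, -, hl⟩ := isCompact_iff_ultrafilter_le_nhds.mp hc ((hyperfilter ℕ).map x) (by
    rw [le_principal_iff, Ultrafilter.coe_map, mem_map]
    exact Eventually.of_forall fun j => abs_le.mp (h j))
  have hl' : Tendsto x (hyperfilter ℕ) (𝓝 l) := hl
  rw [ultraLim, hl'.limUnder_eq]
  exact hl'

theorem ultraLim_eq {x : ℕ → ℝ} {l : ℝ} (h : Tendsto x (hyperfilter ℕ) (𝓝 l)) :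
    ultraLim x = l := h.limUnder_eq

/-! ### Invariant states on commutative algebras -/

/-- A positive functional on a commutative normed algebra, with an action of a group by
contractive algebra endomorphisms that preserve the functional. -/
structure InvariantState (G R : Type*) [CommGroup G] [NormedCommRing R] [NormedAlgebra ℝ R] where
  /-- the functional -/
  state : R →ₗ[ℝ] ℝ
  /-- the action -/
  act : G →* (R →ₐ[ℝ] R)
  state_mul_self_nonneg : ∀ a, 0 ≤ state (a * a)
  state_mul_le : ∀ a b, state (a * b * (a * b)) ≤ ‖a‖ ^ 2 * state (b * b)
  abs_state_le : ∀ a, |state a| ≤ ‖a‖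
  state_act : ∀ g a, state (act g a) = state a
  norm_act_le : ∀ g a, ‖act g a‖ ≤ ‖a‖

namespace InvariantState

/-! ### The Hilbert space of a state. -/

section PreL2

variable {G R : Type*} [CommGroup G] [NormedCommRing R] [NormedAlgebra ℝ R]

set_option linter.unusedVariables false in
/-- The algebra `R` as a pre-inner product space with `⟪a, b⟫ = σ (a * b)`. -/
@[nolint unusedArguments]
def PreL2 (σ : InvariantState G R) := R

variable (σ : InvariantState G R)

noncomputable instance : AddCommGroup σ.PreL2 := inferInstanceAs (AddCommGroup R)
noncomputable instance : Module ℝ σ.PreL2 := inferInstanceAs (Module ℝ R)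

/-- The identity map from `R` to `PreL2`. -/
noncomputable def toPreL2 : R ≃ₗ[ℝ] σ.PreL2 := LinearEquiv.refl ℝ _

/-- The pre-inner product `⟪a, b⟫ = σ (a * b)`. -/
noncomputable abbrev preL2Core : PreInnerProductSpace.Core ℝ σ.PreL2 where
  inner a b := σ.state (σ.toPreL2.symm a * σ.toPreL2.symm b)
  conj_inner_symm a b := by simp [mul_comm]
  re_inner_nonneg a := by simpa using σ.state_mul_self_nonneg _
  add_left a b c := by rw [map_add, add_mul, map_add]
  smul_left a b r := by simp

noncomputable instance : SeminormedAddCommGroup σ.PreL2 :=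
  InnerProductSpace.Core.toSeminormedAddCommGroup (c := σ.preL2Core)
noncomputable instance : InnerProductSpace ℝ σ.PreL2 :=
  InnerProductSpace.ofCore σ.preL2Core

/-- The Hilbert space of an invariant state. -/
abbrev L2 := UniformSpace.Completion σ.PreL2

/-- The canonical map from the algebra to the Hilbert space of the state. -/
noncomputable def toL2 : R →ₗ[ℝ] σ.L2 :=
  (UniformSpace.Completion.toComplL : σ.PreL2 →L[ℝ] σ.L2).toLinearMap ∘ₗ σ.toPreL2.toLinearMap

theorem inner_toL2 (a b : R) : inner ℝ (σ.toL2 a) (σ.toL2 b) = σ.state (a * b) :=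
  UniformSpace.Completion.inner_coe (𝕜 := ℝ) (σ.toPreL2 a) (σ.toPreL2 b)

theorem norm_toL2_sq (a : R) : ‖σ.toL2 a‖ ^ 2 = σ.state (a * a) := by
  rw [← inner_toL2, real_inner_self_eq_norm_sq]

theorem denseRange_toL2 : DenseRange σ.toL2 := by
  have h : DenseRange (UniformSpace.Completion.coe' : σ.PreL2 → σ.L2) :=
    UniformSpace.Completion.denseRange_coe
  exact h.comp σ.toPreL2.surjective.denseRange (UniformSpace.Completion.continuous_coe _)

/-- Multiplication by `a` is bounded on the Hilbert space by the algebra norm. This takes the place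
of the pointwise bound by the supremum norm when the state is not a measure. -/
theorem norm_toL2_mul_le (a b : R) : ‖σ.toL2 (a * b)‖ ≤ ‖a‖ * ‖σ.toL2 b‖ := by
  rw [← sq_le_sq₀ (by positivity) (by positivity), mul_pow, norm_toL2_sq, norm_toL2_sq]
  exact σ.state_mul_le a b

theorem norm_toL2_le (a : R) : ‖σ.toL2 a‖ ≤ ‖a‖ := by
  rw [← sq_le_sq₀ (by positivity) (by positivity), norm_toL2_sq, sq]
  exact (le_abs_self _).trans ((σ.abs_state_le _).trans (norm_mul_le _ _))

theorem norm_toL2_act (g : G) (a : R) : ‖σ.toL2 (σ.act g a)‖ = ‖σ.toL2 a‖ := by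
  rw [← sq_eq_sq₀ (by positivity) (by positivity), norm_toL2_sq, norm_toL2_sq, ← map_mul,
    σ.state_act]

theorem act_act (g h : G) (a : R) : σ.act g (σ.act h a) = σ.act (g * h) a := by
  rw [map_mul]; rfl

end PreL2

end InvariantState

namespace InvariantState

/-! ### Twisted averaging operators and their adjoints. -/

section Twisted

variable {G R : Type*} [CommGroup G] [NormedCommRing R] [NormedAlgebra ℝ R]
variable (σ : InvariantState G R) (t : G) (τ : ℤ → R)

/-- The operator `b ↦ avg_n τ n * (t ^ n • b)`. -/
noncomputable def twistedAvg (p : ℤ) (L : ℕ) : R →ₗ[ℝ] R where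
  toFun b := intervalAvg (fun n => τ n * σ.act (t ^ n) b) p L
  map_add' b c := by simp only [map_add, mul_add, intervalAvg_add]
  map_smul' r b := by simp only [map_smul, mul_smul_comm, intervalAvg_smul, RingHom.id_apply]

theorem twistedAvg_apply (p : ℤ) (L : ℕ) (b : R) :
    σ.twistedAvg t τ p L b = intervalAvg (fun n => τ n * σ.act (t ^ n) b) p L := rfl

/-- The formal adjoint `h ↦ avg_n t ^ (-n) • (h * τ n)` of `twistedAvg`. -/
noncomputable def twistedDual (p : ℤ) (L : ℕ) (h : R) : R :=
  intervalAvg (fun n => σ.act (t ^ (-n)) (h * τ n)) p L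

theorem state_twistedAvg_mul (p : ℤ) (L : ℕ) (b h : R) :
    σ.state (σ.twistedAvg t τ p L b * h) = σ.state (b * σ.twistedDual t τ p L h) := by
  have e1 : σ.twistedAvg t τ p L b * h =
      intervalAvg (fun n => τ n * σ.act (t ^ n) b * h) p L := by
    rw [twistedAvg_apply]
    exact map_intervalAvg (LinearMap.mulRight ℝ h) _ p L
  have e2 : b * σ.twistedDual t τ p L h =
      intervalAvg (fun n => b * σ.act (t ^ (-n)) (h * τ n)) p L :=
    map_intervalAvg (LinearMap.mulLeft ℝ b) _ p L
  rw [e1, e2, map_intervalAvg, map_intervalAvg]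
  congr 1
  funext n
  -- Termwise, invariance of the state under `t ^ n` moves the action off `h * τ n` and onto `b`.
  rw [← σ.state_act (t ^ n) (b * _), map_mul (σ.act (t ^ n)), act_act, ← zpow_add, add_neg_cancel, zpow_zero,
    map_one]
  congr 1
  change _ = σ.act (t ^ n) b * (h * τ n)
  ring

variable {τ} {C : ℝ}

theorem norm_twistedAvg_le (hC : 0 ≤ C) (hτ : ∀ n, ‖τ n‖ ≤ C) (p : ℤ) (L : ℕ) (b : R) :
    ‖σ.twistedAvg t τ p L b‖ ≤ C * ‖b‖ := by
  rw [twistedAvg_apply]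
  refine norm_intervalAvg_le (by positivity) (fun n => ?_) p L
  calc _ ≤ ‖τ n‖ * ‖σ.act (t ^ n) b‖ := norm_mul_le _ _
    _ ≤ C * ‖b‖ := by gcongr; exacts [hτ n, σ.norm_act_le _ _]

theorem norm_toL2_twistedAvg_le (hC : 0 ≤ C) (hτ : ∀ n, ‖τ n‖ ≤ C) (p : ℤ) (L : ℕ) (b : R) :
    ‖σ.toL2 (σ.twistedAvg t τ p L b)‖ ≤ C * ‖σ.toL2 b‖ := by
  rw [twistedAvg_apply, map_intervalAvg]
  refine norm_intervalAvg_le (by positivity) (fun n => ?_) p L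
  calc _ ≤ ‖τ n‖ * ‖σ.toL2 (σ.act (t ^ n) b)‖ := σ.norm_toL2_mul_le _ _
    _ ≤ C * ‖σ.toL2 b‖ := by rw [norm_toL2_act]; gcongr; exact hτ n

theorem norm_twistedDual_le (hC : 0 ≤ C) (hτ : ∀ n, ‖τ n‖ ≤ C) (p : ℤ) (L : ℕ) (h : R) :
    ‖σ.twistedDual t τ p L h‖ ≤ C * ‖h‖ := by
  refine norm_intervalAvg_le (by positivity) (fun n => ?_) p L
  calc _ ≤ ‖h * τ n‖ := σ.norm_act_le _ _
    _ ≤ ‖h‖ * ‖τ n‖ := norm_mul_le _ _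
    _ ≤ C * ‖h‖ := by rw [mul_comm]; gcongr; exact hτ n

variable (τ) in
/-- The extension of `twistedAvg` to the Hilbert space of the state. -/
noncomputable def twistedAvgL2 (p : ℤ) (L : ℕ) : σ.L2 →L[ℝ] σ.L2 :=
  (σ.toL2 ∘ₗ σ.twistedAvg t τ p L).extendOfNorm σ.toL2

theorem twistedAvgL2_toL2 (hC : 0 ≤ C) (hτ : ∀ n, ‖τ n‖ ≤ C) (p : ℤ) (L : ℕ) (b : R) :
    σ.twistedAvgL2 t τ p L (σ.toL2 b) = σ.toL2 (σ.twistedAvg t τ p L b) :=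
  LinearMap.extendOfNorm_eq σ.denseRange_toL2
    ⟨C, fun b => σ.norm_toL2_twistedAvg_le t hC hτ p L b⟩ b

theorem norm_twistedAvgL2_le (hC : 0 ≤ C) (hτ : ∀ n, ‖τ n‖ ≤ C) (p : ℤ) (L : ℕ) (v : σ.L2) :
    ‖σ.twistedAvgL2 t τ p L v‖ ≤ C * ‖v‖ :=
  ContinuousLinearMap.le_of_opNorm_le _ (LinearMap.opNorm_extendOfNorm_le σ.denseRange_toL2 hC
    fun b => σ.norm_toL2_twistedAvg_le t hC hτ p L b) v

theorem inner_twistedAvgL2_toL2 (hC : 0 ≤ C) (hτ : ∀ n, ‖τ n‖ ≤ C) (p : ℤ) (L : ℕ)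
    (v : σ.L2) (h : R) :
    inner ℝ (σ.twistedAvgL2 t τ p L v) (σ.toL2 h) =
      inner ℝ v (σ.toL2 (σ.twistedDual t τ p L h)) := by
  revert v
  rw [← funext_iff]
  refine σ.denseRange_toL2.equalizer (by fun_prop) (by fun_prop) (funext fun b => ?_)
  simp only [Function.comp_apply]
  rw [twistedAvgL2_toL2 σ t hC hτ, inner_toL2, inner_toL2, state_twistedAvg_mul]

/-- The vectors along which the twisted averages converge, uniformly in the interval. -/
noncomputable def cauchySubmodule (τ : ℤ → R) : Submodule ℝ σ.L2 where
  carrier := {v | ∀ ε > 0, ∃ N : ℕ, ∀ q q' M M', N ≤ M → N ≤ M' →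
    ‖σ.twistedAvgL2 t τ q M v - σ.twistedAvgL2 t τ q' M' v‖ ≤ ε}
  zero_mem' ε hε := ⟨0, fun q q' M M' _ _ => by simpa using hε.le⟩
  add_mem' {v w} hv hw ε hε := by
    obtain ⟨N, hN⟩ := hv (ε / 2) (by positivity)
    obtain ⟨N', hN'⟩ := hw (ε / 2) (by positivity)
    refine ⟨max N N', fun q q' M M' h h' => ?_⟩
    have h1 := hN q q' M M' (le_of_max_le_left h) (le_of_max_le_left h')
    have h2 := hN' q q' M M' (le_of_max_le_right h) (le_of_max_le_right h')
    rw [map_add, map_add, add_sub_add_comm]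
    exact (norm_add_le _ _).trans (by linarith)
  smul_mem' r v hv ε hε := by
    obtain ⟨N, hN⟩ := hv (ε / (|r| + 1)) (by positivity)
    refine ⟨N, fun q q' M M' h h' => ?_⟩
    rw [map_smul, map_smul, ← smul_sub, norm_smul, Real.norm_eq_abs]
    have h1 := hN q q' M M' h h'
    rw [le_div_iff₀ (by positivity)] at h1
    nlinarith [norm_nonneg (σ.twistedAvgL2 t τ q M v - σ.twistedAvgL2 t τ q' M' v)]

/-- All the operators have norm at most `C`, so replacing `v` by a nearby vector changes every
average by a uniformly small amount. -/
theorem isClosed_cauchySubmodule (hC : 0 ≤ C) (hτ : ∀ n, ‖τ n‖ ≤ C) :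
    IsClosed (σ.cauchySubmodule t τ : Set σ.L2) := by
  refine isClosed_of_closure_subset fun v hv ε hε => ?_
  obtain ⟨w, hw, hvw⟩ := Metric.mem_closure_iff.mp hv (ε / (3 * (C + 1))) (by positivity)
  obtain ⟨N, hN⟩ := hw (ε / 3) (by positivity)
  refine ⟨N, fun q q' M M' h h' => ?_⟩
  have h1 := hN q q' M M' h h'
  have h2 : C * ‖v - w‖ ≤ ε / 3 := by
    rw [dist_eq_norm, lt_div_iff₀ (by positivity)] at hvw
    nlinarith [norm_nonneg (v - w)]
  have h3 := (σ.norm_twistedAvgL2_le t hC hτ q M (v - w)).trans h2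
  have h4 := (σ.norm_twistedAvgL2_le t hC hτ q' M' (v - w)).trans h2
  have h5 : σ.twistedAvgL2 t τ q M v - σ.twistedAvgL2 t τ q' M' v =
      σ.twistedAvgL2 t τ q M (v - w) + (σ.twistedAvgL2 t τ q M w - σ.twistedAvgL2 t τ q' M' w)
        - σ.twistedAvgL2 t τ q' M' (v - w) := by
    simp only [map_sub]; abel
  rw [h5]
  refine (norm_sub_le _ _).trans ?_
  linarith [norm_add_le (σ.twistedAvgL2 t τ q M (v - w))
    (σ.twistedAvgL2 t τ q M w - σ.twistedAvgL2 t τ q' M' w)]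

end Twisted

/-- Weak limits along an ultrafilter of bounded sequences in a Hilbert space. -/
theorem exists_weak_limit {H : Type*} [NormedAddCommGroup H] [InnerProductSpace ℝ H]
    [CompleteSpace H] {x : ℕ → H} {K : ℝ} (hx : ∀ j, ‖x j‖ ≤ K) :
    ∃ y : H, ∀ v, Tendsto (fun j => inner ℝ (x j) v) (hyperfilter ℕ) (𝓝 (inner ℝ y v)) := by
  have hb : ∀ v j, |inner ℝ (x j) v| ≤ K * ‖v‖ := fun v j =>
    (abs_real_inner_le_norm _ _).trans (by gcongr; exact hx j)
  have ht := fun v => tendsto_ultraLim (hb v)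
  let φ : H →ₗ[ℝ] ℝ :=
    { toFun := fun v => ultraLim fun j => inner ℝ (x j) v
      map_add' := fun v w => ultraLim_eq (by
        simpa only [inner_add_right] using (ht v).add (ht w))
      map_smul' := fun r v => ultraLim_eq (by
        simpa only [real_inner_smul_right, RingHom.id_apply, smul_eq_mul] using (ht v).const_mul r) }
  have hφ : ∀ v, ‖φ v‖ ≤ K * ‖v‖ := fun v =>
    le_of_tendsto (ht v).abs (Eventually.of_forall (hb v))
  refine ⟨(InnerProductSpace.toDual ℝ H).symm (φ.mkContinuous K hφ), fun v => ?_⟩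
  rw [InnerProductSpace.toDual_symm_apply]
  exact ht v

/-! ### Reduction to dual functions. -/

section Structure

variable {G R : Type*} [CommGroup G] [NormedCommRing R] [NormedAlgebra ℝ R]
variable (σ : InvariantState G R) (t : G) {τ : ℤ → R} {C : ℝ}

/-- If twisted averages of bounded sequences of dual functions over longer and longer intervals
are asymptotically Cauchy, then all twisted averages are Cauchy. -/
theorem cauchy_twistedAvg_of_dual (hC : 0 ≤ C) (hτ : ∀ n, ‖τ n‖ ≤ C)
    (hdual : ∀ (p : ℕ → ℤ) (L : ℕ → ℕ), (∀ j, j < L j) → ∀ (h : ℕ → R) (D : ℝ),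
      (∀ j, ‖h j‖ ≤ D) → ∀ η > 0, ∃ N : ℕ, ∀ q q' M M', N ≤ M → N ≤ M' →
        ∀ᶠ j in (hyperfilter ℕ : Filter ℕ),
          ‖σ.toL2 (σ.twistedAvg t τ q M (σ.twistedDual t τ (p j) (L j) (h j)) -
            σ.twistedAvg t τ q' M' (σ.twistedDual t τ (p j) (L j) (h j)))‖ ≤ η)
    (b : R) {ε : ℝ} (hε : 0 < ε) :
    ∃ N : ℕ, ∀ q q' M M', N ≤ M → N ≤ M' →
      ‖σ.toL2 (σ.twistedAvg t τ q M b - σ.twistedAvg t τ q' M' b)‖ ≤ ε := by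
  have hclosed := σ.isClosed_cauchySubmodule t hC hτ
  have : CompleteSpace (σ.cauchySubmodule t τ) := hclosed.completeSpace_coe
  have htop : σ.cauchySubmodule t τ = ⊤ := by
    rw [← Submodule.orthogonal_eq_bot_iff, Submodule.eq_bot_iff]
    intro u hu
    -- A vector in the subspace and orthogonal to it is zero. Membership will follow from the
    -- averages of `u` tending to zero.
    suffices hmem : u ∈ σ.cauchySubmodule t τ from
      inner_self_eq_zero.mp ((Submodule.mem_orthogonal _ _).mp hu u hmem)
    have hsmall : ∀ ε > 0, ∃ N : ℕ, ∀ q M, N ≤ M → ‖σ.twistedAvgL2 t τ q M u‖ ≤ ε := by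
      intro ε hε
      by_contra! hcon
      choose p L hjL hlarge using fun j : ℕ => hcon (j + 1)
      -- The dual functions must be built from algebra elements bounded in norm, so `u` is replaced
      -- by an approximation `u'`; operators of norm at most `C` keep the error below `ε / 2`.
      obtain ⟨u', hu'⟩ := σ.denseRange_toL2.exists_dist_lt u
        (ε := ε / (2 * (C + 1))) (by positivity)
      set h : ℕ → R := fun j => σ.twistedAvg t τ (p j) (L j) u'
      have hh : ∀ j, ‖h j‖ ≤ C * ‖u'‖ := fun j => σ.norm_twistedAvg_le t hC hτ _ _ _
      set d : ℕ → R := fun j => σ.twistedDual t τ (p j) (L j) (h j) with hd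
      have hdb : ∀ j, ‖σ.toL2 (d j)‖ ≤ C * (C * ‖u'‖) := fun j =>
        (σ.norm_toL2_le _).trans ((σ.norm_twistedDual_le t hC hτ _ _ _).trans
          (by gcongr; exact hh j))
      obtain ⟨y, hy⟩ := exists_weak_limit hdb
      -- With `w`, `w'` the averages of `u`, `u'`, duality gives `⟪d j, u⟫ = ⟪w, w'⟫ ≥ ‖w‖ (‖w‖ - ε
      -- / 2)`, and `‖w‖ > ε`.
      have hyu : ε ^ 2 / 2 ≤ inner ℝ y u := by
        refine ge_of_tendsto (hy u) (Eventually.of_forall fun j => ?_)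
        rw [real_inner_comm, hd, ← σ.inner_twistedAvgL2_toL2 t hC hτ,
          ← σ.twistedAvgL2_toL2 t hC hτ]
        set w := σ.twistedAvgL2 t τ (p j) (L j) u
        set w' := σ.twistedAvgL2 t τ (p j) (L j) (σ.toL2 u')
        have h1 : ‖w - w'‖ ≤ ε / 2 := by
          rw [← map_sub]
          refine (σ.norm_twistedAvgL2_le t hC hτ _ _ _).trans ?_
          rw [dist_eq_norm, lt_div_iff₀ (by positivity)] at hu'
          nlinarith [norm_nonneg (u - σ.toL2 u')]
        have h2 : inner ℝ w w' = ‖w‖ ^ 2 - inner ℝ w (w - w') := by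
          rw [inner_sub_right, real_inner_self_eq_norm_sq]; ring
        have h3 := real_inner_le_norm w (w - w')
        have h4 : ε < ‖w‖ := hlarge j
        rw [h2]
        nlinarith [mul_le_mul_of_nonneg_left h1 (norm_nonneg w)]
      have hymem : y ∈ σ.cauchySubmodule t τ := by
        intro η hη
        obtain ⟨N, hN⟩ := hdual p L (fun j => hjL j) h _ hh η hη
        refine ⟨N, fun q q' M M' hM hM' => ?_⟩
        set Δ := σ.twistedAvgL2 t τ q M - σ.twistedAvgL2 t τ q' M' with hΔ
        change ‖Δ y‖ ≤ η
        have hev := hN q q' M M' hM hM'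
        -- Weak convergence passes through `Δ` via its adjoint; testing against `Δ y` itself then
        -- bounds `‖Δ y‖`.
        have hlim : Tendsto (fun j => inner ℝ (Δ (σ.toL2 (d j))) (Δ y)) (hyperfilter ℕ)
            (𝓝 (inner ℝ (Δ y) (Δ y))) := by
          simpa only [ContinuousLinearMap.adjoint_inner_right] using
            hy (ContinuousLinearMap.adjoint Δ (Δ y))
        have hle : inner ℝ (Δ y) (Δ y) ≤ η * ‖Δ y‖ := by
          refine le_of_tendsto hlim ?_
          filter_upwards [hev] with j hj
          refine (real_inner_le_norm _ _).trans ?_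
          gcongr
          rw [hΔ, sub_apply, σ.twistedAvgL2_toL2 t hC hτ,
            σ.twistedAvgL2_toL2 t hC hτ, ← map_sub]
          exact hj
        rw [real_inner_self_eq_norm_sq] at hle
        by_contra! hlt
        nlinarith
      have h0 := (Submodule.mem_orthogonal _ _).mp hu y hymem
      rw [h0] at hyu
      nlinarith [sq_pos_of_pos hε]
    intro ε hε
    obtain ⟨N, hN⟩ := hsmall (ε / 2) (by positivity)
    refine ⟨N, fun q q' M M' h h' => (norm_sub_le _ _).trans ?_⟩
    linarith [hN q M h, hN q' M' h']
  have hb : σ.toL2 b ∈ σ.cauchySubmodule t τ := htop ▸ Submodule.mem_top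
  obtain ⟨N, hN⟩ := hb ε hε
  refine ⟨N, fun q q' M M' h h' => ?_⟩
  rw [map_sub, ← σ.twistedAvgL2_toL2 t hC hτ, ← σ.twistedAvgL2_toL2 t hC hτ]
  exact hN q q' M M' h h'

end Structure

end InvariantState

open scoped BoundedContinuousFunction

namespace InvariantState

/-! ### Bounded families and their mean state. -/

section Mean

variable {G R : Type*} [CommGroup G] [NormedCommRing R] [NormedAlgebra ℝ R]
variable (σ : InvariantState G R) (p : ℕ → ℤ) (L : ℕ → ℕ)

/-- The pointwise action on bounded families of elements of `R`. -/
noncomputable def familyAct : G →* ((ℤ →ᵇ R) →ₐ[ℝ] (ℤ →ᵇ R)) where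
  toFun g :=
    { toFun := fun F => BoundedContinuousFunction.ofNormedAddCommGroupDiscrete
        (fun m => σ.act g (F m)) ‖F‖ fun m => (σ.norm_act_le _ _).trans (F.norm_coe_le_norm m)
      map_one' := by ext m; simp
      map_mul' := fun F F' => by ext m; simp
      map_zero' := by ext m; simp
      map_add' := fun F F' => by ext m; simp
      commutes' := fun r => by
        ext m
        simp only [BoundedContinuousFunction.coe_ofNormedAddCommGroupDiscrete,
          Algebra.algebraMap_eq_smul_one, BoundedContinuousFunction.coe_smul,
          BoundedContinuousFunction.coe_one, Pi.one_apply, map_smul, map_one] }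
  map_one' := by ext F m; simp
  map_mul' g g' := by ext F m; simp

theorem abs_intervalAvg_state_le (F : ℤ →ᵇ R) (j : ℕ) :
    |intervalAvg (fun m => σ.state (F m)) (p j) (L j)| ≤ ‖F‖ := by
  rw [← Real.norm_eq_abs]
  exact norm_intervalAvg_le (norm_nonneg F)
    (fun m => (σ.abs_state_le _).trans (F.norm_coe_le_norm m)) _ _

/-- The state on bounded families `F` of elements of `R` that takes the mean of `σ (F m)` over `m`,
along the ultrafilter limit of the given intervals. -/
noncomputable def meanState : InvariantState G (ℤ →ᵇ R) where
  state :=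
    { toFun := fun F => ultraLim fun j => intervalAvg (fun m => σ.state (F m)) (p j) (L j)
      map_add' := fun F F' => ultraLim_eq (by
        simpa only [BoundedContinuousFunction.coe_add, Pi.add_apply, map_add, intervalAvg_add]
          using (tendsto_ultraLim (σ.abs_intervalAvg_state_le p L F)).add
            (tendsto_ultraLim (σ.abs_intervalAvg_state_le p L F')))
      map_smul' := fun r F => ultraLim_eq (by
        simp only [BoundedContinuousFunction.coe_smul, map_smul, intervalAvg_smul,
          RingHom.id_apply]
        exact (tendsto_ultraLim (σ.abs_intervalAvg_state_le p L F)).const_mul r) }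
  act := σ.familyAct
  state_mul_self_nonneg F :=
    ge_of_tendsto (tendsto_ultraLim (σ.abs_intervalAvg_state_le p L (F * F)))
      (Eventually.of_forall fun j => by
        have h := intervalAvg_mono (c := fun _ => (0 : ℝ))
          (fun m => σ.state_mul_self_nonneg (F m)) (p j) (L j)
        simpa [intervalAvg] using h)
  state_mul_le F F' := by
    refine le_of_tendsto_of_tendsto
      (tendsto_ultraLim (σ.abs_intervalAvg_state_le p L (F * F' * (F * F'))))
      ((tendsto_ultraLim (σ.abs_intervalAvg_state_le p L (F' * F'))).const_mul (‖F‖ ^ 2))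
      (Eventually.of_forall fun j => ?_)
    beta_reduce
    rw [← smul_eq_mul (‖F‖ ^ 2), ← intervalAvg_smul]
    refine intervalAvg_mono (fun m => (σ.state_mul_le (F m) (F' m)).trans ?_) _ _
    rw [smul_eq_mul]
    have h := σ.state_mul_self_nonneg (F' m)
    have h' := F.norm_coe_le_norm m
    change _ ≤ ‖F‖ ^ 2 * σ.state (F' m * F' m)
    gcongr
  abs_state_le F :=
    le_of_tendsto (tendsto_ultraLim (σ.abs_intervalAvg_state_le p L F)).abs
      (Eventually.of_forall (σ.abs_intervalAvg_state_le p L F))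
  state_act g F := by
    change ultraLim (fun j => intervalAvg (fun m => σ.state (σ.act g (F m))) (p j) (L j)) =
      ultraLim _
    simp only [σ.state_act]
  norm_act_le g F :=
    (BoundedContinuousFunction.norm_le (norm_nonneg F)).mpr fun m =>
      (σ.norm_act_le g (F m)).trans (F.norm_coe_le_norm m)

theorem tendsto_meanState (F : ℤ →ᵇ R) :
    Tendsto (fun j => intervalAvg (fun m => σ.state (F m)) (p j) (L j)) (hyperfilter ℕ)
      (𝓝 ((σ.meanState p L).state F)) :=
  tendsto_ultraLim (σ.abs_intervalAvg_state_le p L F)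

end Mean

/-! ### Multiple averages: the inductive step. -/

section MultipleAverages

variable {G R : Type*} [CommGroup G] [NormedCommRing R] [NormedAlgebra ℝ R]
variable (σ : InvariantState G R) {d : ℕ} (s : Fin d → G) (a : Fin d → R)

/-- The product `∏ i, s i ^ n • a i`. -/
noncomputable def multTerm (n : ℤ) : R := ∏ i, σ.act (s i ^ n) (a i)

theorem norm_multTerm_le [NormOneClass R] (n : ℤ) : ‖σ.multTerm s a n‖ ≤ ∏ i, ‖a i‖ :=
  (Finset.norm_prod_le _ _).trans
    (Finset.prod_le_prod (fun _ _ => norm_nonneg _) fun _ _ => σ.norm_act_le _ _)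

theorem intervalAvg_multTerm_succ (s : Fin (d + 1) → G) (a : Fin (d + 1) → R) (p : ℤ) (L : ℕ) :
    intervalAvg (σ.multTerm s a) p L =
      σ.twistedAvg (s 0) (σ.multTerm (Fin.tail s) (Fin.tail a)) p L (a 0) := by
  rw [twistedAvg_apply]
  congr 1
  funext n
  rw [multTerm, Fin.prod_univ_succ, mul_comm]
  rfl

variable (t : G)

/-- The coefficients `a i * (t⁻¹ s i) ^ m • a i` that appear when the averages of a dual function
are computed. -/
noncomputable def crossCoeff (i : Fin d) : ℤ →ᵇ R :=
  BoundedContinuousFunction.ofNormedAddCommGroupDiscrete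
    (fun m => a i * σ.act ((t⁻¹ * s i) ^ m) (a i)) (‖a i‖ * ‖a i‖) fun m =>
      (norm_mul_le _ _).trans (by gcongr; exact σ.norm_act_le _ _)

/-- Commutativity gives `t ^ (-m) * s i ^ (m + l) = s i ^ l * (t⁻¹ * s i) ^ m`. Thus, for fixed `m`,
the terms of the average of a dual function form a multiple average in `l` in which `t` no longer
moves with `l`. -/
theorem act_mul_multTerm_crossCoeff (h : R) (l m : ℤ) :
    σ.act (t ^ (-m)) h * σ.multTerm s (fun i => σ.crossCoeff s a t i m) l =
      σ.multTerm s a l * σ.act (t ^ (l - (m + l))) (h * σ.multTerm s a (m + l)) := by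
  have h1 : l - (m + l) = -m := by ring
  have h2 : ∀ i, t ^ (-m) * s i ^ (m + l) = s i ^ l * (t⁻¹ * s i) ^ m := fun i => by
    rw [mul_zpow, inv_zpow', zpow_add, mul_comm (s i ^ m) (s i ^ l), mul_left_comm]
  have h3 : ∀ i, σ.act (s i ^ l) (σ.crossCoeff s a t i m) =
      σ.act (s i ^ l) (a i) * σ.act (t ^ (-m)) (σ.act (s i ^ (m + l)) (a i)) := fun i => by
    rw [act_act, h2, ← act_act, ← map_mul]
    rfl
  simp only [h1, multTerm, h3, Finset.prod_mul_distrib, map_mul, map_prod]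
  ring

/-- After the substitution `n = m + l`, the two sides differ only in that, for each `l`, the
interval of the dual function is shifted by `l`. With `q` and `M` fixed this costs `O(1 / L)`. -/
theorem norm_twistedAvg_twistedDual_sub_le [NormOneClass R] {D : ℝ} {h : R} (hh : ‖h‖ ≤ D)
    (p : ℤ) (L : ℕ) (q : ℤ) (M : ℕ) :
    ‖σ.twistedAvg t (σ.multTerm s a) q M (σ.twistedDual t (σ.multTerm s a) p L h) -
      intervalAvg (fun m => σ.act (t ^ (-m)) h *
        intervalAvg (σ.multTerm s (fun i => σ.crossCoeff s a t i m)) q M) p L‖ ≤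
      intervalAvg (fun l : ℤ => (l.natAbs : ℝ)) q M *
        ((L : ℝ)⁻¹ * (2 * ((∏ i, ‖a i‖) * (D * ∏ i, ‖a i‖)))) := by
  have hC : 0 ≤ ∏ i, ‖a i‖ := Finset.prod_nonneg fun _ _ => norm_nonneg _
  have e1 : ∀ l, σ.multTerm s a l *
      σ.act (t ^ l) (σ.twistedDual t (σ.multTerm s a) p L h) =
      intervalAvg (fun n => σ.multTerm s a l *
        σ.act (t ^ (l - n)) (h * σ.multTerm s a n)) p L := fun l => by
    rw [twistedDual, map_intervalAvg]
    refine (map_intervalAvg (LinearMap.mulLeft ℝ (σ.multTerm s a l)) _ p L).trans ?_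
    simp only [LinearMap.mulLeft_apply, act_act, ← zpow_add, sub_eq_add_neg]
  have e2 : intervalAvg (fun m => σ.act (t ^ (-m)) h *
        intervalAvg (σ.multTerm s (fun i => σ.crossCoeff s a t i m)) q M) p L =
      intervalAvg (fun l => intervalAvg (fun m => σ.multTerm s a l *
        σ.act (t ^ (l - (m + l))) (h * σ.multTerm s a (m + l))) p L) q M := by
    rw [intervalAvg_comm]
    congr 1
    funext m
    simp only [← act_mul_multTerm_crossCoeff]
    exact map_intervalAvg (LinearMap.mulLeft ℝ (σ.act (t ^ (-m)) h)) _ q M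
  rw [e2, twistedAvg_apply, ← intervalAvg_sub, mul_comm, ← smul_eq_mul, ← intervalAvg_smul]
  refine (norm_intervalAvg_le_intervalAvg _ _ _).trans (intervalAvg_mono (fun l => ?_) _ _)
  rw [e1, norm_sub_rev, smul_eq_mul, mul_comm]
  refine norm_intervalAvg_shift_sub_le (c := fun n => σ.multTerm s a l *
    σ.act (t ^ (l - n)) (h * σ.multTerm s a n)) (fun n => ?_) l p L
  refine (norm_mul_le _ _).trans ?_
  have hb := σ.norm_multTerm_le s a
  refine mul_le_mul (hb l) ?_ (norm_nonneg _) hC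
  refine (σ.norm_act_le _ _).trans ((norm_mul_le _ _).trans ?_)
  exact mul_le_mul hh (hb n) (norm_nonneg _) ((norm_nonneg _).trans hh)

theorem tendsto_twistedAvg_twistedDual_sub [NormOneClass R] {p : ℕ → ℤ} {L : ℕ → ℕ}
    (hL : ∀ j, j < L j) {h : ℕ → R} {D : ℝ} (hh : ∀ j, ‖h j‖ ≤ D) (q : ℤ) (M : ℕ) :
    Tendsto (fun j => ‖σ.twistedAvg t (σ.multTerm s a) q M
        (σ.twistedDual t (σ.multTerm s a) (p j) (L j) (h j)) -
      intervalAvg (fun m => σ.act (t ^ (-m)) (h j) *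
        intervalAvg (σ.multTerm s (fun i => σ.crossCoeff s a t i m)) q M) (p j) (L j)‖)
      atTop (𝓝 0) := by
  refine squeeze_zero (fun _ => norm_nonneg _)
    (fun j => σ.norm_twistedAvg_twistedDual_sub_le s a t (hh j) (p j) (L j) q M) ?_
  have h1 : Tendsto (fun j => (L j : ℝ)⁻¹) atTop (𝓝 0) :=
    tendsto_inv_atTop_zero.comp (tendsto_natCast_atTop_atTop.comp
      (tendsto_atTop_mono (fun j => (hL j).le) tendsto_id))
  simpa using (h1.mul_const (2 * ((∏ i, ‖a i‖) * (D * ∏ i, ‖a i‖)))).const_mul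
    (intervalAvg (fun l : ℤ => (l.natAbs : ℝ)) q M)

/-- By Cauchy–Schwarz over `m`. The weights `t ^ (-m) h` enter only through the bound `D`, so what
remains is exactly the quantity whose limit is `meanState`. -/
theorem norm_toL2_intervalAvg_act_mul_sq_le {D : ℝ} {h : R} (hh : ‖h‖ ≤ D) (F : ℤ → R)
    (p : ℤ) (L : ℕ) :
    ‖σ.toL2 (intervalAvg (fun m => σ.act (t ^ (-m)) h * F m) p L)‖ ^ 2 ≤
      D ^ 2 * intervalAvg (fun m => σ.state (F m * F m)) p L := by
  have hD := (norm_nonneg h).trans hh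
  rw [map_intervalAvg]
  calc _ ≤ intervalAvg (fun m => D * ‖σ.toL2 (F m)‖) p L ^ 2 := by
        gcongr
        refine (norm_intervalAvg_le_intervalAvg _ _ _).trans (intervalAvg_mono (fun m => ?_) _ _)
        refine (σ.norm_toL2_mul_le _ _).trans ?_
        gcongr
        exact (σ.norm_act_le _ _).trans hh
    _ ≤ intervalAvg (fun m => (D * ‖σ.toL2 (F m)‖) ^ 2) p L := intervalAvg_sq_le _ _ _
    _ = _ := by
        simp only [mul_pow, norm_toL2_sq]
        exact intervalAvg_smul (D ^ 2) _ p L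

/-- Multiple averages of commuting automorphisms are Cauchy in the `L²` seminorm of the state,
uniformly over all long intervals. -/
theorem cauchy_multTerm {G : Type*} [CommGroup G] (d : ℕ) :
    ∀ {R : Type*} [NormedCommRing R] [NormedAlgebra ℝ R] [NormOneClass R]
      (σ : InvariantState G R) (s : Fin d → G) (a : Fin d → R) {ε : ℝ}, 0 < ε →
      ∃ N : ℕ, ∀ q q' M M', N ≤ M → N ≤ M' →
        ‖σ.toL2 (intervalAvg (σ.multTerm s a) q M - intervalAvg (σ.multTerm s a) q' M')‖ ≤ ε := by
  induction d with
  | zero =>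
    intro R _ _ _ σ s a ε hε
    -- The empty product is `1`, but an average over an empty interval is `0`; hence length at least
    -- one.
    refine ⟨1, fun q q' M M' hM hM' => ?_⟩
    have h : σ.multTerm s a = fun _ => 1 := by funext n; simp [multTerm]
    rw [h, intervalAvg_const _ _ (by omega), intervalAvg_const _ _ (by omega)]
    simpa using hε.le
  | succ d ih =>
    intro R _ _ _ σ s a ε hε
    simp only [intervalAvg_multTerm_succ]
    set t := s 0
    set s' : Fin d → G := Fin.tail s
    set a' : Fin d → R := Fin.tail a
    refine σ.cauchy_twistedAvg_of_dual t (Finset.prod_nonneg fun _ _ => norm_nonneg _)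
      (σ.norm_multTerm_le s' a') (fun p L hL h D hh η hη => ?_) (a 0) hε
    have hD : 0 ≤ D := (norm_nonneg _).trans (hh 0)
    set F : Fin d → ℤ →ᵇ R := σ.crossCoeff s' a' t
    -- `N` is fixed before `q`, `q'`, `M`, `M'`; only the set of good `j` depends on these.
    obtain ⟨N, hN⟩ := ih (σ.meanState p L) s' F (ε := η / (4 * (D + 1))) (by positivity)
    refine ⟨N, fun q q' M M' hM hM' => ?_⟩
    set Δ := intervalAvg ((σ.meanState p L).multTerm s' F) q M -
      intervalAvg ((σ.meanState p L).multTerm s' F) q' M'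
    have hΔ : ∀ m, Δ m = intervalAvg (σ.multTerm s' (fun i => F i m)) q M -
        intervalAvg (σ.multTerm s' (fun i => F i m)) q' M' := fun m => by
      have e : ∀ q M, intervalAvg ((σ.meanState p L).multTerm s' F) q M m =
          intervalAvg (σ.multTerm s' (fun i => F i m)) q M := fun q M => by
        refine (map_intervalAvg (BoundedContinuousFunction.evalCLM ℝ m) _ q M).trans ?_
        congr 1
        funext n
        let ev : (ℤ →ᵇ R) →+* R :=
          { toFun := fun F => F m
            map_one' := rfl
            map_mul' := fun _ _ => rfl
            map_zero' := rfl
            map_add' := fun _ _ => rfl }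
        exact map_prod ev _ _
      rw [← e, ← e]
      rfl
    -- Doubling the bound makes it strict, so it passes from the ultrafilter limit to the averages
    -- at individual `j`.
    have hmean : (σ.meanState p L).state (Δ * Δ) < (η / (2 * (D + 1))) ^ 2 := by
      rw [← norm_toL2_sq]
      refine (pow_le_pow_left₀ (norm_nonneg _) (hN q q' M M' hM hM') 2).trans_lt ?_
      gcongr
      norm_num
    have hev1 := ((σ.tendsto_meanState p L (Δ * Δ)).eventually_lt_const hmean)
    have hle : ((hyperfilter ℕ : Ultrafilter ℕ) : Filter ℕ) ≤ atTop := Nat.hyperfilter_le_atTop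
    have hev2 := hle (((σ.tendsto_twistedAvg_twistedDual_sub s' a' t (p := p) hL hh q M)
      ).eventually_lt_const (show (0 : ℝ) < η / 4 by positivity))
    have hev3 := hle (((σ.tendsto_twistedAvg_twistedDual_sub s' a' t (p := p) hL hh q' M')
      ).eventually_lt_const (show (0 : ℝ) < η / 4 by positivity))
    filter_upwards [hev1, hev2, hev3] with j h1 h2 h3
    set A := σ.twistedAvg t (σ.multTerm s' a') q M
      (σ.twistedDual t (σ.multTerm s' a') (p j) (L j) (h j))
    set A' := σ.twistedAvg t (σ.multTerm s' a') q' M'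
      (σ.twistedDual t (σ.multTerm s' a') (p j) (L j) (h j))
    set B := intervalAvg (fun m => σ.act (t ^ (-m)) (h j) *
        intervalAvg (σ.multTerm s' (fun i => F i m)) q M) (p j) (L j)
    set B' := intervalAvg (fun m => σ.act (t ^ (-m)) (h j) *
        intervalAvg (σ.multTerm s' (fun i => F i m)) q' M') (p j) (L j)
    have hB : B - B' = intervalAvg (fun m => σ.act (t ^ (-m)) (h j) * Δ m) (p j) (L j) := by
      simp only [hΔ, mul_sub, intervalAvg_sub]
      rfl
    have h4 : ‖σ.toL2 (B - B')‖ ≤ η / 2 := by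
      refine le_of_sq_le_sq ?_ (by positivity)
      rw [hB]
      refine (σ.norm_toL2_intervalAvg_act_mul_sq_le t (hh j) (fun m => Δ m) _ _).trans ?_
      calc D ^ 2 * intervalAvg (fun m => σ.state (Δ m * Δ m)) (p j) (L j)
          ≤ D ^ 2 * (η / (2 * (D + 1))) ^ 2 := by gcongr; exact h1.le
        _ = (D / (D + 1) * (η / 2)) ^ 2 := by field_simp
        _ ≤ (1 * (η / 2)) ^ 2 := by
            gcongr
            rw [div_le_one (by positivity)]
            linarith
        _ = (η / 2) ^ 2 := by ring
    -- The error is `η / 4 + η / 2 + η / 4`: two changes of variables and one use of induction.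
    have h5 : A - A' = (A - B) + (B - B') - (A' - B') := by abel
    rw [h5, map_sub, map_add]
    refine (norm_sub_le _ _).trans ?_
    have h6 := norm_add_le (σ.toL2 (A - B)) (σ.toL2 (B - B'))
    have h7 := (σ.norm_toL2_le (A - B)).trans h2.le
    have h8 := (σ.norm_toL2_le (A' - B')).trans h3.le
    linarith

end MultipleAverages

end InvariantState

/-! ### From measure-preserving maps to an invariant state. -/

section Measure

variable {X : Type*} [MeasurableSpace X]

/-- The subalgebra of bounded measurable functions, on a set with the discrete topology. -/
def boundedMeasurableSubalgebra (X : Type*) [MeasurableSpace X] [TopologicalSpace X] :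
    Subalgebra ℝ (X →ᵇ ℝ) where
  carrier := {f | Measurable f}
  mul_mem' hf hg := Measurable.mul hf hg
  add_mem' hf hg := Measurable.add hf hg
  algebraMap_mem' _ := measurable_const

/-- The algebra of bounded measurable functions, on a set with the discrete topology. -/
def BoundedMeasurable (X : Type*) [MeasurableSpace X] [TopologicalSpace X] : Type _ :=
  boundedMeasurableSubalgebra X

namespace BoundedMeasurable

variable [TopologicalSpace X]

noncomputable instance : NormedCommRing (BoundedMeasurable X) :=
  inferInstanceAs (NormedCommRing (boundedMeasurableSubalgebra X))

noncomputable instance : NormedAlgebra ℝ (BoundedMeasurable X) :=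
  inferInstanceAs (NormedAlgebra ℝ (boundedMeasurableSubalgebra X))

instance [Nonempty X] : NormOneClass (BoundedMeasurable X) :=
  ⟨norm_one (α := X →ᵇ ℝ)⟩

instance : CoeFun (BoundedMeasurable X) fun _ => X → ℝ := ⟨fun f => f.1⟩

theorem measurable (f : BoundedMeasurable X) : Measurable f := f.2

theorem norm_apply_le (f : BoundedMeasurable X) (x : X) : ‖f x‖ ≤ ‖f‖ :=
  f.1.norm_coe_le_norm x

theorem memLp (f : BoundedMeasurable X) (μ : Measure X) [IsProbabilityMeasure μ] (p : ℝ≥0∞) :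
    MemLp f p μ :=
  MemLp.of_bound f.measurable.aestronglyMeasurable ‖f‖ (Eventually.of_forall f.norm_apply_le)

theorem integrable (f : BoundedMeasurable X) (μ : Measure X) [IsProbabilityMeasure μ] :
    Integrable f μ :=
  memLp_one_iff_integrable.mp (f.memLp μ 1)

/-- Evaluation at a point. -/
noncomputable def eval (x : X) : BoundedMeasurable X →ₐ[ℝ] ℝ where
  toFun f := f x
  map_one' := rfl
  map_mul' _ _ := rfl
  map_zero' := rfl
  map_add' _ _ := rfl
  commutes' _ := rfl

theorem eval_apply (x : X) (f : BoundedMeasurable X) : eval x f = f x := rfl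

@[ext]
theorem ext {f g : BoundedMeasurable X} (h : ∀ x, f x = g x) : f = g :=
  Subtype.ext (BoundedContinuousFunction.ext h)

variable [DiscreteTopology X]

/-- Composition with a measurable permutation, as a map on bounded measurable functions. -/
noncomputable def compPerm (g : Equiv.Perm X) (hg : Measurable g) :
    BoundedMeasurable X →ₐ[ℝ] BoundedMeasurable X where
  toFun f := ⟨f.1.compContinuous ⟨g, continuous_of_discreteTopology⟩, f.measurable.comp hg⟩
  map_one' := rfl
  map_mul' _ _ := rfl
  map_zero' := rfl
  map_add' _ _ := rfl
  commutes' _ := rfl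

theorem compPerm_apply (g : Equiv.Perm X) (hg : Measurable g) (f : BoundedMeasurable X) (x : X) :
    compPerm g hg f x = f (g x) := rfl

end BoundedMeasurable

/-- Integration on bounded measurable functions, with the action of a commutative group by
measure-preserving permutations. -/
noncomputable def InvariantState.ofMeasure [TopologicalSpace X] [DiscreteTopology X]
    (μ : Measure X) [IsProbabilityMeasure μ] {G : Type*}
    [CommGroup G] (π : G →* Equiv.Perm X) (hπ : ∀ g, MeasurePreserving (π g) μ μ) :
    InvariantState G (BoundedMeasurable X) where
  state :=
    { toFun := fun f => ∫ x, f x ∂μ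
      map_add' := fun f g => integral_add (f.integrable μ) (g.integrable μ)
      map_smul' := fun r f => integral_const_mul r _ }
  act :=
    { toFun := fun g => BoundedMeasurable.compPerm (π g) (hπ g).measurable
      map_one' := by
        ext f x
        rw [BoundedMeasurable.compPerm_apply, map_one]
        rfl
      map_mul' := fun g h => by
        ext f x
        -- Composition reverses the order of products; commutativity makes it a homomorphism.
        rw [BoundedMeasurable.compPerm_apply, mul_comm g h, map_mul]
        rfl }
  state_mul_self_nonneg f := integral_nonneg fun x => mul_self_nonneg _
  state_mul_le f g := by
    change ∫ x, f x * g x * (f x * g x) ∂μ ≤ ‖f‖ ^ 2 * ∫ x, g x * g x ∂μ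
    rw [← integral_const_mul]
    refine integral_mono ((f * g * (f * g)).integrable μ)
      (((g * g).integrable μ).const_mul _) fun x => ?_
    have h := f.norm_apply_le x
    have h2 : f x ^ 2 ≤ ‖f‖ ^ 2 := sq_le_sq' (abs_le.mp h).1 (abs_le.mp h).2
    nlinarith [mul_le_mul_of_nonneg_right h2 (sq_nonneg (g x))]
  abs_state_le f := by
    have h := norm_integral_le_of_norm_le_const (μ := μ) (f := f)
      (Eventually.of_forall f.norm_apply_le)
    rwa [probReal_univ, mul_one] at h
  state_act g f := by
    have h := integral_map (μ := μ) (hπ g).measurable.aemeasurable (f := f)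
      f.measurable.aestronglyMeasurable
    rw [(hπ g).map_eq] at h
    exact h.symm
  norm_act_le g f :=
    (BoundedContinuousFunction.norm_le (norm_nonneg _)).mpr fun x => f.norm_apply_le (π g x)

/-- The group of measure-preserving permutations with measure-preserving inverse. -/
def measurePreservingPerm (μ : Measure X) : Subgroup (Equiv.Perm X) where
  carrier := {g | MeasurePreserving g μ μ ∧ MeasurePreserving (g⁻¹ : Equiv.Perm X) μ μ}
  mul_mem' {g h} hg hh := ⟨hg.1.comp hh.1, by rw [mul_inv_rev]; exact hh.2.comp hg.2⟩
  one_mem' := ⟨MeasurePreserving.id μ, by rw [inv_one]; exact MeasurePreserving.id μ⟩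
  inv_mem' {g} hg := ⟨hg.2, by rw [inv_inv]; exact hg.1⟩

theorem toEquiv_mem_measurePreservingPerm {μ : Measure X} {S : X ≃ᵐ X}
    (hS : MeasurePreserving S μ μ) :
    (S.toEquiv : Equiv.Perm X) ∈ measurePreservingPerm μ :=
  ⟨hS, hS.symm S⟩

theorem Finset.exists_eq_Ico_of_ordConnected {I : Finset ℤ} (hI : (I : Set ℤ).OrdConnected)
    (hne : I.Nonempty) : ∃ p : ℤ, I = Finset.Ico p (p + I.card) := by
  have h : I = Finset.Icc (I.min' hne) (I.max' hne) := by
    ext n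
    rw [Finset.mem_Icc]
    exact ⟨fun hn => ⟨I.min'_le n hn, I.le_max' n hn⟩, fun hn =>
      hI.out (Finset.mem_coe.mpr (I.min'_mem hne)) (Finset.mem_coe.mpr (I.max'_mem hne)) hn⟩
  have hle := I.min'_le _ (I.max'_mem hne)
  refine ⟨I.min' hne, ?_⟩
  have hc : (I.card : ℤ) = I.max' hne + 1 - I.min' hne := by
    conv_lhs => rw [h]
    rw [Int.card_Icc]
    omega
  conv_lhs => rw [h]
  ext n
  simp only [Finset.mem_Icc, Finset.mem_Ico]
  omega

theorem intervalAvg_eq_of_ordConnected {I : Finset ℤ} (hI : (I : Set ℤ).OrdConnected)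
    (hne : I.Nonempty) :
    ∃ p : ℤ, ∀ c : ℤ → ℝ, 1 / (I.card : ℝ) * ∑ n ∈ I, c n = intervalAvg c p I.card := by
  obtain ⟨p, hp⟩ := Finset.exists_eq_Ico_of_ordConnected hI hne
  refine ⟨p, fun c => ?_⟩
  rw [intervalAvg, one_div, smul_eq_mul]
  congr 1
  conv_lhs => rw [hp]
  refine (Finset.sum_bij (fun (k : ℕ) _ => p + (k : ℤ)) ?_ ?_ ?_ ?_).symm
  · intro k hk
    simp only [Finset.mem_range, Finset.mem_Ico] at hk ⊢
    omega
  · intro k _ k' _ h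
    omega
  · intro n hn
    rw [Finset.mem_Ico] at hn
    exact ⟨(n - p).toNat, by simp only [Finset.mem_range]; omega, by omega⟩
  · intro k _
    rfl

/-- An essentially bounded function agrees almost everywhere with a bounded measurable one. -/
theorem MeasureTheory.MemLp.exists_bounded_measurable {μ : Measure X} {f : X → ℝ}
    (hf : MemLp f ∞ μ) : ∃ (f' : X → ℝ) (C : ℝ), Measurable f' ∧ (∀ x, ‖f' x‖ ≤ C) ∧ f =ᵐ[μ] f' := by
  set C := (eLpNorm f ∞ μ).toReal
  have hC : 0 ≤ C := ENNReal.toReal_nonneg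
  set f₀ := hf.1.mk f
  have hm : Measurable f₀ := hf.1.stronglyMeasurable_mk.measurable
  refine ⟨fun x => max (-C) (min C (f₀ x)), C, by fun_prop, fun x => ?_, ?_⟩
  · rw [Real.norm_eq_abs, abs_le]
    exact ⟨le_max_left _ _, max_le (by linarith) (min_le_left _ _)⟩
  · filter_upwards [hf.1.ae_eq_mk, ae_le_eLpNormEssSup (μ := μ) (f := f)] with x h1 h2
    have h3 : |f x| ≤ C := by
      rw [← eLpNorm_exponent_top] at h2
      have := ENNReal.toReal_mono hf.2.ne h2
      rwa [toReal_enorm, Real.norm_eq_abs] at this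
    have h4 : f₀ x = f x := h1.symm
    rw [h4, min_eq_right (abs_le.mp h3).2, max_eq_right (abs_le.mp h3).1]

theorem transPow_ae_eq {μ : Measure X} {S : X ≃ᵐ X} (hS : MeasurePreserving S μ μ) (n : ℤ)
    {f f' : X → ℝ} (h : f =ᵐ[μ] f') : transPow S n f =ᵐ[μ] transPow S n f' :=
  ((measurePreservingPerm μ).zpow_mem (toEquiv_mem_measurePreservingPerm hS) n
    ).1.quasiMeasurePreserving.ae_eq_comp h

theorem multipleAverage_ae_eq {μ : Measure X} {d : ℕ} {S : Fin d → X ≃ᵐ X}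
    (hS : ∀ i, MeasurePreserving (S i) μ μ) {f f' : Fin d → X → ℝ} (h : ∀ i, f i =ᵐ[μ] f' i)
    (I : Finset ℤ) : multipleAverage S f I =ᵐ[μ] multipleAverage S f' I := by
  have h1 : ∀ᵐ x ∂μ, ∀ i, ∀ n : ℤ, transPow (S i) n (f i) x = transPow (S i) n (f' i) x := by
    rw [ae_all_iff]
    intro i
    rw [ae_all_iff]
    exact fun n => transPow_ae_eq (hS i) n (h i)
  filter_upwards [h1] with x hx
  simp only [multipleAverage, hx]

/-- Completeness of `L²` supplies the limit function. -/
theorem ConvergesInL2.of_cauchy {μ : Measure X} {F : ℕ → X → ℝ} (hF : ∀ j, MemLp (F j) 2 μ)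
    (hc : ∀ ε > 0, ∃ N, ∀ j k, N ≤ j → N ≤ k → ∫ x, (F j x - F k x) ^ 2 ∂μ ≤ ε ^ 2) :
    ConvergesInL2 μ F := by
  have hdist : ∀ j k, dist ((hF j).toLp (F j)) ((hF k).toLp (F k)) ^ 2 =
      ∫ x, (F j x - F k x) ^ 2 ∂μ := fun j k => by
    rw [dist_eq_norm, ← MemLp.toLp_sub, ← real_inner_self_eq_norm_sq, L2.inner_def]
    refine integral_congr_ae ?_
    filter_upwards [((hF j).sub (hF k)).coeFn_toLp] with x hx
    rw [hx]
    simp [sq]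
  have hcauchy : CauchySeq fun j => (hF j).toLp (F j) := by
    rw [Metric.cauchySeq_iff']
    intro ε hε
    obtain ⟨N, hN⟩ := hc (ε / 2) (by positivity)
    refine ⟨N, fun j hj => ?_⟩
    have h := hN j N hj le_rfl
    rw [← hdist] at h
    exact (le_of_sq_le_sq h (by positivity)).trans_lt (by linarith)
  obtain ⟨g, hg⟩ := cauchySeq_tendsto_of_complete hcauchy
  refine ⟨hF, g, Lp.memLp g, ?_⟩
  rw [← Lp.tendsto_Lp_iff_tendsto_eLpNorm'' F hF g (Lp.memLp g), Lp.toLp_coeFn]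
  exact hg

end Measure

/-! ### The convergence theorem. -/

theorem theorem1p1 {X : Type*} [MeasurableSpace X] (μ : Measure X) [IsProbabilityMeasure μ]
    (d : ℕ) (S : Fin d → X ≃ᵐ X)
    (hS : ∀ i, MeasurePreserving (S i) μ μ)
    (hcomm : ∀ i j, Function.Commute (S i) (S j))
    (f : Fin d → X → ℝ) (hf : ∀ i, MemLp (f i) ∞ μ)
    (I : ℕ → Finset ℤ) (hI : ∀ j, (I j : Set ℤ).OrdConnected)
    (hlen : Tendsto (fun j => (I j).card) atTop atTop) :
    ConvergesInL2 μ (fun j => multipleAverage S f (I j)) := by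
  -- With the discrete topology every function is continuous, so bounded measurable functions form a
  -- subalgebra of `X →ᵇ ℝ`.
  let : TopologicalSpace X := ⊥
  have : DiscreteTopology X := ⟨rfl⟩
  have : Nonempty X := nonempty_of_isProbabilityMeasure μ
  choose f' C hf'm hf'C hff' using fun i => (hf i).exists_bounded_measurable
  let a : Fin d → BoundedMeasurable X := fun i =>
    ⟨BoundedContinuousFunction.ofNormedAddCommGroupDiscrete (f' i) (C i) (hf'C i), hf'm i⟩
  -- The acting commutative group is the one generated by the transformations.
  set K : Subgroup (Equiv.Perm X) :=
    Subgroup.closure (Set.range fun i => ((S i).toEquiv : Equiv.Perm X)) with hK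
  have hKcomm : IsMulCommutative K := Subgroup.isMulCommutative_closure (by
    rintro _ ⟨i, rfl⟩ _ ⟨j, rfl⟩
    exact Equiv.ext (hcomm i j))
  let : CommGroup K := { (inferInstance : Group K) with mul_comm := hKcomm.is_comm.comm }
  have hKμ : K ≤ measurePreservingPerm μ := by
    rw [hK, Subgroup.closure_le]
    rintro _ ⟨i, rfl⟩
    exact toEquiv_mem_measurePreservingPerm (hS i)
  let σ : InvariantState K (BoundedMeasurable X) :=
    InvariantState.ofMeasure μ K.subtype fun g => (hKμ g.2).1
  let s : Fin d → K := fun i => ⟨(S i).toEquiv, Subgroup.subset_closure ⟨i, rfl⟩⟩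
  have hterm : ∀ n x, BoundedMeasurable.eval x (σ.multTerm s a n) =
      ∏ i, transPow (S i) n (f' i) x := fun n x => by
    rw [InvariantState.multTerm, map_prod]
    rfl
  have havg : ∀ p L x, BoundedMeasurable.eval x (intervalAvg (σ.multTerm s a) p L) =
      intervalAvg (fun n => ∏ i, transPow (S i) n (f' i) x) p L := fun p L x => by
    rw [map_intervalAvg]
    simp only [hterm]
  have hrep : ∀ j, ∃ b : BoundedMeasurable X, multipleAverage S f (I j) =ᵐ[μ] b ∧
      ((I j).Nonempty → ∃ p, b = intervalAvg (σ.multTerm s a) p (I j).card) := by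
    intro j
    rcases (I j).eq_empty_or_nonempty with h | h
    · refine ⟨0, ?_, fun h' => absurd h (Finset.nonempty_iff_ne_empty.mp h')⟩
      refine Eventually.of_forall fun x => ?_
      simp only [multipleAverage, h, Finset.sum_empty, mul_zero]
      rfl
    · obtain ⟨p, hp⟩ := intervalAvg_eq_of_ordConnected (hI j) h
      refine ⟨intervalAvg (σ.multTerm s a) p (I j).card, ?_, fun _ => ⟨p, rfl⟩⟩
      filter_upwards [multipleAverage_ae_eq hS hff' (I j)] with x hx
      rw [hx, ← BoundedMeasurable.eval_apply, havg, ← hp]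
      rfl
  choose b hb hbp using hrep
  refine ConvergesInL2.of_cauchy (fun j => ((b j).memLp μ 2).ae_eq (hb j).symm) fun ε hε => ?_
  obtain ⟨N, hN⟩ := InvariantState.cauchy_multTerm d σ s a hε
  -- The `1` ensures that the intervals are nonempty, so each has a starting point.
  obtain ⟨J, hJ⟩ := eventually_atTop.mp (hlen.eventually_ge_atTop (max N 1))
  refine ⟨J, fun j k hj hk => ?_⟩
  have hcard : ∀ j, J ≤ j → N ≤ (I j).card ∧ (I j).Nonempty := fun j hj =>
    ⟨le_of_max_le_left (hJ j hj), Finset.card_pos.mp (le_of_max_le_right (hJ j hj))⟩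
  obtain ⟨p, hp⟩ := hbp j (hcard j hj).2
  obtain ⟨q, hq⟩ := hbp k (hcard k hk).2
  have h := pow_le_pow_left₀ (norm_nonneg _) (hN p q _ _ (hcard j hj).1 (hcard k hk).1) 2
  rw [← hp, ← hq, InvariantState.norm_toL2_sq] at h
  refine le_trans (le_of_eq ?_) h
  change _ = ∫ x, ((b j - b k) * (b j - b k)) x ∂μ
  refine integral_congr_ae ?_
  filter_upwards [hb j, hb k] with x hxj hxk
  rw [hxj, hxk, sq]
  rfl
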